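/- Let $\mathcal H$ be a real Hilbert space and $m\ge 2$. For a set-valued operator $A$ on a real Hilbert space, write $\operatorname{zer}A=\{x:0\in A(x)\}$, $\operatorname{Fix}A=\{x:x\in A(x)\}$, $J_{\gamma A}=(\mathrm{Id}+\gamma A)^{-1}$, $J_{\gamma A}^{\lambda}=\lambda J_{\gamma A}+(1-\lambda)\mathrm{Id}$ and ${}^{\gamma}\!A=\frac1\gamma(\mathrm{Id}-J_{\gamma A})$. The operator $A$ is $\sigma$-comonotone if $\langle x-y,u-v\rangle\ge\sigma\|u-v\|^2$ for all $(x,u),(y,v)$ in its graph, and maximal $\sigma$-comonotone if in addition no $\sigma$-comonotone operator has a graph properly containing that of $A$. Let $A_i:\mathcal H\rightrightarrows\mathcal H$ be maximal $\sigma_i$-comonotone for $i=1,\dots,m$, with $\operatorname{zer}(A_1+\cdots+A_m)\neq\emptyset$, $\sigma_i>0$ for $i=1,\dots,m-1$, $\sigma_m<0$ and $\sum_{i=1}^m\frac1{\sigma_i}<0$. On $\mathcal H^{m-1}$ let $\mathbf D=\{(x,\dots,x):x\in\mathcal H\}$, with normal cone operator $N_{\mathbf D}$, and put $$\mathbf F(\mathbf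 x)=A_1(x_1)\times\cdots\times A_{m-1}(x_{m-1}),\qquad \mathbf G(\mathbf x)=\mathbf K(\mathbf x)+N_{\mathbf D}(\mathbf x),$$ where $\mathbf K(\mathbf x)=\{\frac1{m-1}(v,\dots,v):v\in A_m(x_1)\}$ if $\mathbf x\in\mathbf D$ and $\mathbf K(\mathbf x)=\emptyset$ otherwise. Let $\gamma,\delta,\lambda,\mu>0$ satisfy $(\lambda-1)(\mu-1)=1$ and $\delta=\gamma(\lambda-1)$, let $\kappa\in(0,1)$, and let $\theta=(\theta_1,\dots,\theta_{m-1})$ belong to $$\Theta=\Bigl\{\theta\in\mathbb R^{m-1}:\ \theta_i>0,\ \sigma_i+\sigma_m\theta_i>0\ \ \forall i,\ \ \sum_{i=1}^{m-1}\frac1{\theta_i}=1\Bigr\}.$$ For $i=1,\dots,m-1$ set $$\kappa_i^*=\frac{4(\gamma+\sigma_i)(\delta+\sigma_m\theta_i)-(\gamma+\delta)^2}{2(\gamma+\delta)(\sigma_i+\sigma_m\theta_i)}.$$ Suppose that either (a) $\min_{1\le i\le m-1}\kappa_i^*\ge1$, or (b) $\gamma=\delta$, $\lambda=\mu=2$ and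 $\min_{1\le i\le m-1}\kappa_i^*>\kappa$. Let $T_{\mathbf F,\mathbf G}=(1-\kappa)\mathrm{Id}+\kappa J^{\mu}_{\delta\mathbf G}J^{\lambda}_{\gamma\mathbf F}$, and let $\{(\mathbf x^k,\mathbf y^k,\mathbf z^k)\}_{k\ge0}$ be generated, from an arbitrary initial point $\mathbf x^0\in\mathcal H^{m-1}$, by $$\mathbf y^k\in J_{\gamma\mathbf F}(\mathbf x^k),\qquad \mathbf z^k\in J_{\delta\mathbf G}\bigl((1-\lambda)\mathbf x^k+\lambda\mathbf y^k\bigr),\qquad \mathbf x^{k+1}=\mathbf x^k+\kappa\mu(\mathbf z^k-\mathbf y^k).$$ Then there exists $\bar{\mathbf x}\in\operatorname{Fix}(T_{\mathbf F,\mathbf G})$ at which $J_{\gamma\mathbf F}$ is single-valued, with $J_{\gamma\mathbf F}(\bar{\mathbf x})\in\operatorname{zer}(\mathbf F+\mathbf G)$, such that: (i) $\mathbf x^k\rightharpoonup\bar{\mathbf x}$ weakly; (ii) $\|\mathbf x^k-\mathbf x^{k+1}\|=o(1/\sqrt k)$ and $\|\mathbf y^k-\mathbf y^{k+1}\|=o(1/\sqrt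 k)$ as $k\to\infty$; (iii) $\mathbf y^k\rightharpoonup J_{\gamma\mathbf F}(\bar{\mathbf x})$ and $\mathbf z^k\rightharpoonup J_{\gamma\mathbf F}(\bar{\mathbf x})$ weakly; (iv) $\mathbf x^k-\mathbf y^k$ and $\mathbf x^k-\mathbf z^k$ converge strongly to $\gamma\,{}^{\gamma}\mathbf F(\bar{\mathbf x})=\bar{\mathbf x}-J_{\gamma\mathbf F}(\bar{\mathbf x})$, and $\gamma\,{}^{\gamma}\mathbf F(\bar{\mathbf x})+\operatorname{zer}(\mathbf F+\mathbf G)=\operatorname{Fix}(T_{\mathbf F,\mathbf G})$. -/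

import Mathlib

open Filter Topology Asymptotics
open scoped Pointwise InnerProductSpace

noncomputable section

namespace ADR

section Operators

variable {E : Type*} [NormedAddCommGroup E] [InnerProductSpace ℝ E]

/-- The inverse of a set-valued operator: `(u, x) ∈ gra A⁻¹` iff `(x, u) ∈ gra A`. -/
def inverseOp (A : E → Set E) : E → Set E := fun u => {x | u ∈ A x}

/-- The zeros of a set-valued operator. -/
def zer (A : E → Set E) : Set E := {x | (0 : E) ∈ A x}

/-- The fixed points of a set-valued operator. -/
def fixOp (A : E → Set E) : Set E := {x | x ∈ A x}

/-- The composition `B ∘ A` of set-valued operators. -/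
def compOp (B A : E → Set E) : E → Set E := fun x => ⋃ y ∈ A x, B y

/-- `A` is `σ`-comonotone. -/
def IsComonotone (σ : ℝ) (A : E → Set E) : Prop :=
  ∀ x u y v : E, u ∈ A x → v ∈ A y → σ * ‖u - v‖ ^ 2 ≤ ⟪x - y, u - v⟫_ℝ

/-- `A` is maximal `σ`-comonotone: it is `σ`-comonotone, and every pair that satisfies the
`σ`-comonotonicity inequality against the whole graph of `A` lies in the graph of `A`. -/
def IsMaximalComonotone (σ : ℝ) (A : E → Set E) : Prop :=
  IsComonotone σ A ∧
    ∀ x u : E, (∀ y v : E, v ∈ A y → σ * ‖u - v‖ ^ 2 ≤ ⟪x - y, u - v⟫_ℝ) → u ∈ A x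

/-- The resolvent `J_{γA} = (Id + γA)⁻¹`, as a set-valued operator. -/
def resolventOp (γ : ℝ) (A : E → Set E) : E → Set E :=
  inverseOp (fun x => {x} + γ • A x)

/-- The relaxed resolvent `J_{γA}^lam = lam J_{γA} + (1 - lam) Id`. -/
def relaxedResolventOp (lam γ : ℝ) (A : E → Set E) : E → Set E :=
  fun x => lam • resolventOp γ A x + {(1 - lam) • x}

/-- The Yosida approximation `(1/γ) (Id - J_{γA})`. -/
def yosidaOp (γ : ℝ) (A : E → Set E) : E → Set E :=
  fun x => γ⁻¹ • ({x} - resolventOp γ A x)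

/-- The adaptive Douglas-Rachford operator
`T_{A,B} = (1 - κ) Id + κ J_{δB}^μ ∘ J_{γA}^lam`. -/
def aDROp (κ γ δ lam μ : ℝ) (A B : E → Set E) : E → Set E :=
  fun x => {(1 - κ) • x} +
    κ • compOp (relaxedResolventOp μ δ B) (relaxedResolventOp lam γ A) x

/-- `(x^k, y^k, z^k)` is generated by the adaptive Douglas-Rachford algorithm for `(A, B)`
(from the initial point `x 0`). -/
def IsADRSequence (κ γ δ lam μ : ℝ) (A B : E → Set E) (x y z : ℕ → E) : Prop :=
  ∀ k : ℕ,
    y k ∈ resolventOp γ A (x k) ∧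
    z k ∈ resolventOp δ B ((1 - lam) • x k + lam • y k) ∧
    x (k + 1) = x k + (κ * μ) • (z k - y k)

/-- The normal cone operator of a set `C`. -/
def normalConeOp (C : Set E) : E → Set E :=
  fun x => {w | x ∈ C ∧ ∀ c ∈ C, ⟪w, c - x⟫_ℝ ≤ 0}

/-- Convergence of a sequence in the weak topology. -/
def WeaklyTendsto (x : ℕ → E) (a : E) : Prop :=
  Tendsto (fun k => toWeakSpace ℝ E (x k)) atTop (𝓝 (toWeakSpace ℝ E a))

end Operators

section Product

variable {H : Type*} [NormedAddCommGroup H] [InnerProductSpace ℝ H] {n : ℕ}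

/-- The Hilbert product space `H^n`. -/
abbrev ProdSpace (H : Type*) (n : ℕ) : Type _ := PiLp 2 (fun _ : Fin n => H)

/-- The element `(a, …, a)` of `H^n`. -/
def constVec (n : ℕ) (a : H) : ProdSpace H n := WithLp.toLp 2 (fun _ => a)

/-- The diagonal of `H^n`. -/
def diagonal (H : Type*) (n : ℕ) : Set (ProdSpace H n) := {x | ∀ i j, x i = x j}

/-- `F(x) = A_1(x_1) × ⋯ × A_n(x_n)`. -/
def opF (A : Fin n → H → Set H) : ProdSpace H n → Set (ProdSpace H n) :=
  fun x => {u | ∀ i, u i ∈ A i (x i)}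

/-- `K(a, …, a) = {(1/n) (v, …, v) : v ∈ B(a)}`, and `K(x) = ∅` off the diagonal. -/
def opK (n : ℕ) (B : H → Set H) : ProdSpace H n → Set (ProdSpace H n) :=
  fun x => {w | ∃ a : H, x = constVec n a ∧ ∃ v ∈ B a, w = (n : ℝ)⁻¹ • constVec n v}

/-- `G = K + N_D`, where `D` is the diagonal of `H^n`. -/
def opG (n : ℕ) (B : H → Set H) : ProdSpace H n → Set (ProdSpace H n) :=
  fun x => opK n B x + normalConeOp (diagonal H n) x

end Product

/-- The set `Θ` of weights for moduli `σ_1, …, σ_{n+1}`. -/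
def Theta {n : ℕ} (σ : Fin (n + 1) → ℝ) : Set (Fin n → ℝ) :=
  {θ | (∀ i, 0 < θ i ∧ 0 < σ i.castSucc + σ (Fin.last n) * θ i) ∧ ∑ i, 1 / θ i = 1}

/-- The numbers `κ_i^*`, `i = 1, …, n`. -/
def kappaStar {n : ℕ} (γ δ : ℝ) (σ : Fin (n + 1) → ℝ) (θ : Fin n → ℝ) (i : Fin n) : ℝ :=
  (4 * (γ + σ i.castSucc) * (δ + σ (Fin.last n) * θ i) - (γ + δ) ^ 2) /
    (2 * (γ + δ) * (σ i.castSucc + σ (Fin.last n) * θ i))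

end ADR

end

open ADR

/-!
Every algorithm step is read on the graphs of `F` and `G`. With `u = (x - y) / γ ∈ F y` and
`w = (y - z) / δ - u ∈ G z`, the relations between the parameters turn one step into
`x⁺ = x - κ (γ + δ) (u + w)`, where `x = y + γ u` and `y - z = δ (u + w)`. The fixed points are
exactly the points `p + γ v` with `v ∈ F p` and `-v ∈ G p` (`mem_fixOp_aDROp`).

`F` is comonotone with modulus `σ_i` in the `i`-th coordinate. Only the sum of the coordinates of a
value of `G` is constrained (`mem_opG_iff`), so by Cauchy–Schwarz with the weights `θ` the operator
`G` is comonotone with modulus `σ_m θ_i` in the `i`-th coordinate. Adding the two inequalities gives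
for each coordinate a quadratic form in the differences of `u` and `w`; the number
`κ_i^* (γ + δ) / 2` is the largest multiple of `‖u + w‖²` that this form dominates
(`quadratic_form_nonneg`). Since `κ < κ_i^*` for all `i`, the step is an averaged operation in `x`
(`step_contraction`). This yields Fejér monotonicity, summability of `‖x^k - x^{k+1}‖²`, and
monotonicity of these norms, whence the rate `o(1/√k)`.

The displacements `u + w` tend to zero. As `σ_i + σ_m θ_i > 0`, the sum of the comonotonicity
inequalities at the iterates and at a solution forces `u` to converge in norm to the dual solution
`v`, which is unique (`tendsto_dual`, `dual_solution_unique`). Maximality makes the graphs of the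
`A_i` closed for weak convergence of the points and norm convergence of the values, so every weak
cluster point of `x` is a fixed point, with no appeal to surjectivity of the resolvents, and Opial's
lemma (`exists_innerTendsto_of_opial`) gives weak convergence.
-/

namespace ADR

/-! ### Weak convergence in Hilbert spaces -/

section Weak

variable {E : Type*} [NormedAddCommGroup E] [InnerProductSpace ℝ E]

/-- Weak convergence along an arbitrary filter, tested against inner products. -/
def InnerTendsto (x : ℕ → E) (l : Filter ℕ) (a : E) : Prop :=
  ∀ v : E, Tendsto (fun k => ⟪x k, v⟫_ℝ) l (𝓝 ⟪a, v⟫_ℝ)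

theorem InnerTendsto.add_tendsto {x e : ℕ → E} {l : Filter ℕ} {a b : E}
    (hx : InnerTendsto x l a) (he : Tendsto e l (𝓝 b)) :
    InnerTendsto (fun k => x k + e k) l (a + b) := by
  intro v
  simp only [inner_add_left]
  exact (hx v).add (he.inner tendsto_const_nhds)

/-- Inner products pass to the limit when one factor converges weakly and stays bounded and the
other one converges in norm. -/
theorem InnerTendsto.inner_tendsto {x e : ℕ → E} {l : Filter ℕ} {a b : E} {C : ℝ}
    (hx : InnerTendsto x l a) (hC : ∀ k, ‖x k‖ ≤ C) (he : Tendsto e l (𝓝 b)) :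
    Tendsto (fun k => ⟪x k, e k⟫_ℝ) l (𝓝 ⟪a, b⟫_ℝ) := by
  have h0 : Tendsto (fun k => ⟪x k, e k - b⟫_ℝ) l (𝓝 0) := by
    have h1 : Tendsto (fun k => C * ‖e k - b‖) l (𝓝 0) := by
      simpa using (tendsto_iff_norm_sub_tendsto_zero.1 he).const_mul C
    refine squeeze_zero_norm (fun k => ?_) h1
    exact (norm_inner_le_norm _ _).trans
      (mul_le_mul_of_nonneg_right (hC k) (norm_nonneg _))
  have h2 := (hx b).add h0
  rw [add_zero] at h2
  refine h2.congr fun k => ?_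
  rw [inner_sub_right]
  ring

variable [CompleteSpace E]

/-- Bounded sequences have weak limits along ultrafilters (Banach–Alaoglu and Riesz). -/
theorem exists_innerTendsto_ultrafilter {x : ℕ → E} {C : ℝ} (hC : ∀ k, ‖x k‖ ≤ C)
    (U : Ultrafilter ℕ) : ∃ a, InnerTendsto x U a := by
  let f : ℕ → WeakDual ℝ E := fun k =>
    StrongDual.toWeakDual (InnerProductSpace.toDual ℝ E (x k))
  have hK := WeakDual.isCompact_closedBall (𝕜 := ℝ) (0 : StrongDual ℝ E) C
  obtain ⟨g, -, hg⟩ := hK.ultrafilter_le_nhds (U.map f) (by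
    rw [le_principal_iff]
    refine Filter.Eventually.of_forall (f := (U : Filter ℕ)) fun k => ?_
    simpa [f] using hC k)
  refine ⟨(InnerProductSpace.toDual ℝ E).symm (WeakDual.toStrongDual g), fun v => ?_⟩
  have h1 : Tendsto f U (𝓝 g) := hg
  have h2 := ((WeakDual.eval_continuous (𝕜 := ℝ) v).tendsto g).comp h1
  rw [InnerProductSpace.toDual_symm_apply]
  exact h2

/-- Weak convergence in the weak space topology follows from convergence of all inner products. -/
theorem InnerTendsto.weaklyTendsto {x : ℕ → E} {a : E} (h : InnerTendsto x atTop a) :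
    WeaklyTendsto x a := by
  have hind : IsInducing (fun (y : WeakSpace ℝ E) (φ : StrongDual ℝ E) =>
      φ ((toWeakSpace ℝ E).symm y)) := ⟨rfl⟩
  refine hind.tendsto_nhds_iff.2 ?_
  rw [tendsto_pi_nhds]
  intro φ
  have h1 := h ((InnerProductSpace.toDual ℝ E).symm φ)
  have h2 : ∀ w : E, ⟪w, (InnerProductSpace.toDual ℝ E).symm φ⟫_ℝ = φ w := fun w => by
    rw [real_inner_comm, InnerProductSpace.toDual_symm_apply]
  simp only [h2] at h1
  exact h1

/-- Opial's lemma: if the distance to every point of `S` converges and every weak cluster point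
lies in `S`, then the whole sequence converges weakly to a point of `S`. -/
theorem exists_innerTendsto_of_opial {x : ℕ → E} {C : ℝ} (hC : ∀ k, ‖x k‖ ≤ C) (S : Set E)
    (hS : ∀ a ∈ S, ∃ r : ℝ, Tendsto (fun k => ‖x k - a‖ ^ 2) atTop (𝓝 r))
    (hcl : ∀ (U : Ultrafilter ℕ) (a : E), (U : Filter ℕ) ≤ atTop → InnerTendsto x U a → a ∈ S) :
    ∃ a ∈ S, InnerTendsto x atTop a := by
  obtain ⟨a, ha⟩ := exists_innerTendsto_ultrafilter hC (Ultrafilter.of atTop)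
  have haS := hcl _ a (Ultrafilter.of_le _) ha
  refine ⟨a, haS, fun v => ?_⟩
  rw [tendsto_iff_ultrafilter]
  intro U hU
  obtain ⟨b, hb⟩ := exists_innerTendsto_ultrafilter hC U
  have hbS := hcl U b hU hb
  obtain ⟨r, hr⟩ := hS a haS
  obtain ⟨q, hq⟩ := hS b hbS
  -- The inner products with `a - b` converge along the whole sequence, hence agree at `a` and `b`.
  have hlim : Tendsto (fun k => ⟪x k, a - b⟫_ℝ) atTop
      (𝓝 ((q - r + ‖a‖ ^ 2 - ‖b‖ ^ 2) / 2)) := by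
    refine ((((hq.sub hr).add_const (‖a‖ ^ 2)).sub_const (‖b‖ ^ 2)).div_const 2).congr fun k => ?_
    rw [norm_sub_sq_real, norm_sub_sq_real, inner_sub_right]
    ring
  have e1 := tendsto_nhds_unique (ha (a - b)) (hlim.mono_left (Ultrafilter.of_le _))
  have e2 := tendsto_nhds_unique (hb (a - b)) (hlim.mono_left hU)
  have hab : a = b := by
    rw [← sub_eq_zero, ← inner_self_eq_zero (𝕜 := ℝ), inner_sub_left, e1, e2, sub_self]
  subst hab
  exact hb v

end Weak

/-! ### Rate of convergence of antitone square-summable sequences -/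

theorem tendsto_mul_of_antitone_of_summable {f : ℕ → ℝ} (hf : Antitone f) (h0 : ∀ k, 0 ≤ f k)
    (hs : Summable f) : Tendsto (fun k : ℕ => (k : ℝ) * f k) atTop (𝓝 0) := by
  have h1 := hs.hasSum.tendsto_sum_nat
  have h2 : Tendsto (fun k : ℕ => 2 * (∑ i ∈ Finset.range k, f i - ∑ i ∈ Finset.range (k / 2), f i))
      atTop (𝓝 0) := by
    have h3 := h1.comp (Nat.tendsto_div_const_atTop (n := 2) (by norm_num))
    simpa using (h1.sub h3).const_mul 2
  refine squeeze_zero (fun k => mul_nonneg k.cast_nonneg (h0 k)) (fun k => ?_) h2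
  rw [← Finset.sum_Ico_eq_sub _ (Nat.div_le_self k 2)]
  have h4 : ((k - k / 2 : ℕ) : ℝ) * f k ≤ ∑ i ∈ Finset.Ico (k / 2) k, f i := by
    have := Finset.card_nsmul_le_sum (Finset.Ico (k / 2) k) f (f k)
      (fun i hi => hf (Finset.mem_Ico.1 hi).2.le)
    simpa using this
  have h5 : (k : ℝ) ≤ 2 * ((k - k / 2 : ℕ) : ℝ) := by
    exact_mod_cast (show k ≤ 2 * (k - k / 2) by omega)
  nlinarith [h0 k]

theorem isLittleO_one_div_sqrt {f : ℕ → ℝ} (hf : Antitone f) (h0 : ∀ k, 0 ≤ f k)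
    (hs : Summable fun k => f k ^ 2) : f =o[atTop] (fun k : ℕ => 1 / √(k : ℝ)) := by
  have h1 := tendsto_mul_of_antitone_of_summable (f := fun k => f k ^ 2)
    (fun i j hij => pow_le_pow_left₀ (h0 j) (hf hij) 2) (fun k => sq_nonneg _) hs
  refine isLittleO_of_tendsto' ?_ ?_
  · filter_upwards [eventually_gt_atTop 0] with k hk h
    have : 0 < 1 / √(k : ℝ) := by positivity
    exact absurd h this.ne'
  · have h2 := (Real.continuous_sqrt.tendsto 0).comp h1
    rw [Real.sqrt_zero] at h2
    refine h2.congr fun k => ?_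
    simp only [Function.comp]
    rw [Real.sqrt_mul k.cast_nonneg, Real.sqrt_sq (h0 k), div_div_eq_mul_div, div_one, mul_comm]

/-! ### The product operators -/

section Product

variable {H : Type*} [NormedAddCommGroup H] [InnerProductSpace ℝ H] {n : ℕ}

/-- Comonotonicity on `H^n` with a separate modulus `s i` for each coordinate. -/
def IsWeightedComonotone (s : Fin n → ℝ) (F : ProdSpace H n → Set (ProdSpace H n)) : Prop :=
  ∀ x u y v, u ∈ F x → v ∈ F y → ∑ i, s i * ‖u i - v i‖ ^ 2 ≤ ⟪x - y, u - v⟫_ℝ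

/-- The graph is closed for bounded weak convergence of the points and norm convergence of the
values, along arbitrary filters. -/
def IsWeakStrongClosed {E : Type*} [NormedAddCommGroup E] [InnerProductSpace ℝ E]
    (F : E → Set E) : Prop :=
  ∀ (l : Filter ℕ) [l.NeBot] (x u : ℕ → E) (a b : E) (C : ℝ), (∀ k, u k ∈ F (x k)) →
    (∀ k, ‖x k‖ ≤ C) → InnerTendsto x l a → Tendsto u l (𝓝 b) → b ∈ F a

theorem IsMaximalComonotone.isWeakStrongClosed {σ : ℝ} {A : H → Set H}
    (hA : IsMaximalComonotone σ A) : IsWeakStrongClosed A := by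
  intro l _ x u a b C hu hC hx hub
  refine hA.2 a b fun y v hv => ?_
  have h1 : InnerTendsto (fun k => x k - y) l (a - y) := by
    simpa [sub_eq_add_neg] using hx.add_tendsto (tendsto_const_nhds (x := -y))
  have h2 : ∀ k, ‖x k - y‖ ≤ C + ‖y‖ := fun k =>
    (norm_sub_le _ _).trans (by linarith [hC k])
  exact le_of_tendsto_of_tendsto (((hub.sub_const v).norm.pow 2).const_mul σ)
    (h1.inner_tendsto h2 (hub.sub_const v))
    (Eventually.of_forall fun k => hA.1 _ _ _ _ (hu k) hv)

theorem InnerTendsto.coord {x : ℕ → ProdSpace H n} {l : Filter ℕ} {a : ProdSpace H n}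
    (h : InnerTendsto x l a) (i : Fin n) : InnerTendsto (fun k => x k i) l (a i) := by
  classical
  intro v
  have h1 := h (WithLp.toLp 2 (Pi.single i v))
  have h2 : ∀ b : ProdSpace H n, ⟪b, WithLp.toLp 2 (Pi.single i v)⟫_ℝ = ⟪b i, v⟫_ℝ := fun b => by
    rw [PiLp.inner_apply, Finset.sum_eq_single i]
    · simp
    · intro j _ hj
      simp [hj]
    · simp
  simpa only [h2] using h1

theorem tendsto_coord {H : Type*} [NormedAddCommGroup H] {n : ℕ} {u : ℕ → ProdSpace H n} {l : Filter ℕ} {b : ProdSpace H n}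
    (h : Tendsto u l (𝓝 b)) (i : Fin n) : Tendsto (fun k => u k i) l (𝓝 (b i)) :=
  ((PiLp.continuous_apply 2 (fun _ : Fin n => H) i).tendsto b).comp h

theorem isWeightedComonotone_opF {s : Fin n → ℝ} {A : Fin n → H → Set H}
    (hA : ∀ i, IsComonotone (s i) (A i)) : IsWeightedComonotone s (opF A) := by
  intro x u y v hu hv
  rw [PiLp.inner_apply]
  exact Finset.sum_le_sum fun i _ => hA i _ _ _ _ (hu i) (hv i)

theorem isWeakStrongClosed_opF {A : Fin n → H → Set H}
    (hA : ∀ i, IsWeakStrongClosed (A i)) : IsWeakStrongClosed (opF A) := by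
  intro l _ x u a b C hu hC hx hub i
  exact hA i l _ _ _ _ C (fun k => hu k i) (fun k => (PiLp.norm_apply_le (x k) i).trans (hC k))
    (hx.coord i) (tendsto_coord hub i)

/-- The normal cone to the diagonal is its orthogonal complement, so that only the sum of the
coordinates of a value of `G` matters. -/
theorem mem_opG_iff (hn : n ≠ 0) {B : H → Set H} {x w : ProdSpace H n} :
    w ∈ opG n B x ↔ ∃ a, x = constVec n a ∧ ∑ i, w i ∈ B a := by
  have hn' : (n : ℝ) ≠ 0 := Nat.cast_ne_zero.2 hn
  have inner_const : ∀ (d : ProdSpace H n) (h : H), ⟪d, constVec n h⟫_ℝ = ⟪∑ i, d i, h⟫_ℝ := by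
    intro d h
    rw [PiLp.inner_apply, sum_inner]
    rfl
  constructor
  · rintro ⟨_, ⟨a, rfl, v, hv, rfl⟩, d, ⟨-, hd⟩, rfl⟩
    refine ⟨a, rfl, ?_⟩
    -- Testing the normal cone inequality at `x + (S, …, S)` with `S = ∑ d_i` gives `‖S‖² ≤ 0`.
    have hd0 : ∑ i, d i = 0 := by
      have h1 := hd (constVec n a + constVec n (∑ i, d i)) (fun i j => rfl)
      rw [add_sub_cancel_left, inner_const, real_inner_self_eq_norm_sq] at h1
      exact norm_eq_zero.1 (pow_eq_zero_iff two_ne_zero |>.1 (le_antisymm h1 (sq_nonneg _)))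
    have : ∑ i, ((n : ℝ)⁻¹ • constVec n v + d) i = v := by
      simp only [PiLp.add_apply, PiLp.smul_apply, Finset.sum_add_distrib, hd0, add_zero, constVec,
        Finset.sum_const, Finset.card_univ, Fintype.card_fin]
      rw [← Nat.cast_smul_eq_nsmul ℝ, smul_smul, mul_inv_cancel₀ hn', one_smul]
    rwa [this]
  · rintro ⟨a, rfl, hv⟩
    refine ⟨_, ⟨a, rfl, _, hv, rfl⟩, w - (n : ℝ)⁻¹ • constVec n (∑ i, w i),
      ⟨fun i j => rfl, fun c hc => ?_⟩, add_sub_cancel _ _⟩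
    have hsub : c - constVec n a = constVec n (c ⟨0, Nat.pos_of_ne_zero hn⟩ - a) := by
      ext i
      simp [constVec, hc i ⟨0, Nat.pos_of_ne_zero hn⟩]
    rw [hsub, inner_const]
    simp only [PiLp.sub_apply, PiLp.smul_apply, Finset.sum_sub_distrib, constVec,
        Finset.sum_const, Finset.card_univ, Fintype.card_fin]
    rw [← Nat.cast_smul_eq_nsmul ℝ, smul_smul, mul_inv_cancel₀ hn', one_smul, sub_self,
      inner_zero_left]

/-- A negative modulus of `B` splits over the coordinates with weights `θ`, by Cauchy–Schwarz. -/
theorem isWeightedComonotone_opG {τ : ℝ} (hτ : τ < 0) {θ : Fin n → ℝ} (hθ : ∀ i, 0 < θ i)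
    (hθ1 : ∑ i, 1 / θ i = 1) (hn : n ≠ 0) {B : H → Set H} (hB : IsComonotone τ B) :
    IsWeightedComonotone (fun i => τ * θ i) (opG n B) := by
  intro x u y v hu hv
  obtain ⟨a, rfl, ha⟩ := (mem_opG_iff hn).1 hu
  obtain ⟨b, rfl, hb⟩ := (mem_opG_iff hn).1 hv
  have h1 := hB _ _ _ _ ha hb
  have h2 : ⟪constVec n a - constVec n b, u - v⟫_ℝ = ⟪a - b, ∑ i, u i - ∑ i, v i⟫_ℝ := by
    rw [PiLp.inner_apply, ← Finset.sum_sub_distrib, inner_sum]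
    rfl
  rw [h2]
  refine le_trans ?_ h1
  simp only [mul_assoc, ← Finset.mul_sum]
  refine mul_le_mul_of_nonpos_left ?_ hτ.le
  rw [← Finset.sum_sub_distrib]
  calc ‖∑ i, (u i - v i)‖ ^ 2 ≤ (∑ i, ‖u i - v i‖) ^ 2 :=
        pow_le_pow_left₀ (norm_nonneg _) (norm_sum_le _ _) 2
    _ ≤ (∑ i, 1 / θ i) * ∑ i, θ i * ‖u i - v i‖ ^ 2 := by
        refine Finset.sum_sq_le_sum_mul_sum_of_sq_le_mul _
          (fun i _ => (one_div_pos.2 (hθ i)).le)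
          (fun i _ => mul_nonneg (hθ i).le (sq_nonneg _)) fun i _ => ?_
        rw [← mul_assoc, one_div_mul_cancel (hθ i).ne', one_mul]
    _ = ∑ i, θ i * ‖u i - v i‖ ^ 2 := by rw [hθ1, one_mul]

theorem isWeakStrongClosed_opG (hn : n ≠ 0) {B : H → Set H} (hB : IsWeakStrongClosed B) :
    IsWeakStrongClosed (opG n B) := by
  intro l _ x u a b C hu hC hx hub
  choose c hc hcB using fun k => (mem_opG_iff hn).1 (hu k)
  have hxc : ∀ k i, x k i = c k := fun k i => by rw [hc k]; rfl
  let i₀ : Fin n := ⟨0, Nat.pos_of_ne_zero hn⟩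
  have hw : ∀ i, InnerTendsto c l (a i) := fun i => by
    simpa only [hxc] using hx.coord i
  have ha : a = constVec n (a i₀) := by
    ext i
    refine ext_inner_right ℝ fun v => ?_
    exact tendsto_nhds_unique (hw i v) (hw i₀ v)
  refine (mem_opG_iff hn).2 ⟨a i₀, ha, ?_⟩
  refine hB l c (fun k => ∑ i, u k i) _ _ C hcB (fun k => ?_) (hw i₀)
    (tendsto_finsetSum _ fun i _ => tendsto_coord hub i)
  rw [← hxc k i₀]
  exact (PiLp.norm_apply_le (x k) i₀).trans (hC k)

end Product

/-! ### Contraction estimate and convergence of the iteration -/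

section Iteration

theorem tendsto_zero_of_norm_sq {E : Type*} [NormedAddCommGroup E] {f : ℕ → E}
    (h : Tendsto (fun k => ‖f k‖ ^ 2) atTop (𝓝 0)) : Tendsto f atTop (𝓝 0) := by
  rw [tendsto_zero_iff_norm_tendsto_zero]
  have h1 := (Real.continuous_sqrt.tendsto 0).comp h
  rw [Real.sqrt_zero] at h1
  exact h1.congr fun k => Real.sqrt_sq (norm_nonneg _)

/-- When `c` makes the quadratic form on the left degenerate, `s + t` times the form is a square. -/
theorem quadratic_form_nonneg {H : Type*} [NormedAddCommGroup H] [InnerProductSpace ℝ H]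
    {γ δ s t c : ℝ} (hst : 0 < s + t)
    (hc : 4 * c * (s + t) = 4 * (γ + s) * (δ + t) - (γ + δ) ^ 2) (u w : H) :
    c * ‖u + w‖ ^ 2 ≤ (s + γ) * ‖u‖ ^ 2 + (t + δ) * ‖w‖ ^ 2 + (γ + δ) * ⟪u, w⟫_ℝ := by
  have h1 := sq_nonneg ‖(s + (γ - δ) / 2) • u - (t + (δ - γ) / 2) • w‖
  rw [norm_sub_sq_real, norm_smul, norm_smul, mul_pow, mul_pow, Real.norm_eq_abs,
    Real.norm_eq_abs, sq_abs, sq_abs, real_inner_smul_left, real_inner_smul_right] at h1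
  rw [norm_add_sq_real]
  refine le_of_mul_le_mul_left ?_ hst
  linear_combination h1 + (‖u‖ ^ 2 + 2 * ⟪u, w⟫_ℝ + ‖w‖ ^ 2) / 4 * hc

variable {H : Type*} [NormedAddCommGroup H] [InnerProductSpace ℝ H] {n : ℕ}
  {F G : ProdSpace H n → Set (ProdSpace H n)} {s t : Fin n → ℝ} {γ δ : ℝ}

/-- The displacement `u + w` of the algorithm, as a function of the governing point `y + γ u`, is
weighted comonotone with the moduli `c`. -/
theorem displacement_comonotone (hF : IsWeightedComonotone s F) (hG : IsWeightedComonotone t G)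
    (hst : ∀ i, 0 < s i + t i) {c : Fin n → ℝ}
    (hc : ∀ i, 4 * c i * (s i + t i) = 4 * (γ + s i) * (δ + t i) - (γ + δ) ^ 2)
    {y z u w y' z' u' w' : ProdSpace H n} (hu : u ∈ F y) (hw : w ∈ G z) (hu' : u' ∈ F y')
    (hw' : w' ∈ G z') (hd : y - z = δ • (u + w)) (hd' : y' - z' = δ • (u' + w')) :
    ∑ i, c i * ‖(u + w) i - (u' + w') i‖ ^ 2 ≤
      ⟪(y + γ • u) - (y' + γ • u'), (u + w) - (u' + w')⟫_ℝ := by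
  have h1 := hF _ _ _ _ hu hu'
  have h2 := hG _ _ _ _ hw hw'
  have hz : z - z' = (y - y') - δ • ((u - u') + (w - w')) := by
    have ez : z = y - δ • (u + w) := by rw [← hd]; abel
    have ez' : z' = y' - δ • (u' + w') := by rw [← hd']; abel
    rw [ez, ez']
    module
  have e1 : (y + γ • u) - (y' + γ • u') = (y - y') + γ • (u - u') := by module
  have e2 : (u + w) - (u' + w') = (u - u') + (w - w') := by abel
  have h3 : ∑ i, c i * ‖(u + w) i - (u' + w') i‖ ^ 2 ≤
      ∑ i, ((s i + γ) * ‖u i - u' i‖ ^ 2 + (t i + δ) * ‖w i - w' i‖ ^ 2 +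
        (γ + δ) * ⟪u i - u' i, w i - w' i⟫_ℝ) := by
    refine Finset.sum_le_sum fun i _ => ?_
    have h := quadratic_form_nonneg (hst i) (hc i) (u i - u' i) (w i - w' i)
    have e : (u + w) i - (u' + w') i = u i - u' i + (w i - w' i) := by
      simp only [PiLp.add_apply]
      abel
    rwa [e]
  have h4 : ∑ i, ((s i + γ) * ‖u i - u' i‖ ^ 2 + (t i + δ) * ‖w i - w' i‖ ^ 2 +
        (γ + δ) * ⟪u i - u' i, w i - w' i⟫_ℝ) =
      ∑ i, s i * ‖u i - u' i‖ ^ 2 + ∑ i, t i * ‖w i - w' i‖ ^ 2 + γ * ‖u - u'‖ ^ 2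
        + δ * ‖w - w'‖ ^ 2 + (γ + δ) * ⟪u - u', w - w'⟫_ℝ := by
    rw [PiLp.norm_sq_eq_of_L2, PiLp.norm_sq_eq_of_L2, PiLp.inner_apply]
    simp only [Finset.mul_sum, ← Finset.sum_add_distrib, PiLp.sub_apply]
    exact Finset.sum_congr rfl fun i _ => by ring
  rw [hz, inner_sub_left, real_inner_smul_left, inner_add_left, real_inner_self_eq_norm_sq] at h2
  refine h3.trans ?_
  rw [h4, e1, e2, inner_add_left, inner_add_right, real_inner_smul_left, inner_add_right,
    real_inner_self_eq_norm_sq]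
  linarith

/-- One step of the iteration, seen as a map of the governing point `y + γ u`, is averaged. -/
theorem step_contraction (hF : IsWeightedComonotone s F) (hG : IsWeightedComonotone t G)
    (hst : ∀ i, 0 < s i + t i) {c : Fin n → ℝ}
    (hc : ∀ i, 4 * c i * (s i + t i) = 4 * (γ + s i) * (δ + t i) - (γ + δ) ^ 2)
    {a η : ℝ} (ha : 0 ≤ a) (hη : ∀ i, η ≤ 2 * c i - a)
    {y z u w y' z' u' w' : ProdSpace H n} (hu : u ∈ F y) (hw : w ∈ G z) (hu' : u' ∈ F y')
    (hw' : w' ∈ G z') (hd : y - z = δ • (u + w)) (hd' : y' - z' = δ • (u' + w')) :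
    ‖(y + γ • u - a • (u + w)) - (y' + γ • u' - a • (u' + w'))‖ ^ 2 ≤
      ‖(y + γ • u) - (y' + γ • u')‖ ^ 2 - a * η * ‖(u + w) - (u' + w')‖ ^ 2 := by
  have h1 := displacement_comonotone hF hG hst hc hu hw hu' hw' hd hd'
  have h2 : (a + η) / 2 * ‖(u + w) - (u' + w')‖ ^ 2 ≤
      ∑ i, c i * ‖(u + w) i - (u' + w') i‖ ^ 2 := by
    rw [PiLp.norm_sq_eq_of_L2, Finset.mul_sum]
    exact Finset.sum_le_sum fun i _ =>
      mul_le_mul_of_nonneg_right (by linarith [hη i]) (sq_nonneg _)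
  have e1 : (y + γ • u - a • (u + w)) - (y' + γ • u' - a • (u' + w')) =
      ((y + γ • u) - (y' + γ • u')) - a • ((u + w) - (u' + w')) := by module
  rw [e1, norm_sub_sq_real, norm_smul, mul_pow, Real.norm_eq_abs, sq_abs, real_inner_smul_right]
  nlinarith [mul_le_mul_of_nonneg_left (h2.trans h1) ha]

/-- Strong comonotonicity of the sum `F + G` along pairs of points that are close to each other. -/
theorem sum_comonotone_le (hF : IsWeightedComonotone s F) (hG : IsWeightedComonotone t G)
    {y z u w p v : ProdSpace H n} (hu : u ∈ F y) (hw : w ∈ G z) (hv : v ∈ F p) (hv' : -v ∈ G p) :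
    ∑ i, s i * ‖u i - v i‖ ^ 2 + ∑ i, t i * ‖w i + v i‖ ^ 2 ≤
      ⟪y - z, u - v⟫_ℝ + ⟪z - p, u + w⟫_ℝ := by
  have h1 := hF _ _ _ _ hu hv
  have h2 := hG _ _ _ _ hw hv'
  have e1 : y - p = (y - z) + (z - p) := by abel
  have e2 : u + w = (u - v) + (w - -v) := by abel
  rw [e1, inner_add_left] at h1
  rw [e2, inner_add_right]
  simp only [PiLp.neg_apply, sub_neg_eq_add] at h2 ⊢
  linarith

/-- All solutions share the same element of `F`. -/
theorem dual_solution_unique (hF : IsWeightedComonotone s F) (hG : IsWeightedComonotone t G)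
    (hst : ∀ i, 0 < s i + t i) {p v q r : ProdSpace H n} (hv : v ∈ F p) (hv' : -v ∈ G p)
    (hr : r ∈ F q) (hr' : -r ∈ G q) : v = r := by
  have h1 := sum_comonotone_le hF hG hv hv' hr hr'
  rw [sub_self, inner_zero_left, add_neg_cancel, inner_zero_right, add_zero,
    ← Finset.sum_add_distrib] at h1
  have h2 : ∀ i, s i * ‖v i - r i‖ ^ 2 + t i * ‖(-v) i + r i‖ ^ 2 =
      (s i + t i) * ‖v i - r i‖ ^ 2 := fun i => by
    rw [PiLp.neg_apply, neg_add_eq_sub, norm_sub_rev (r i)]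
    ring
  simp only [h2] at h1
  have h3 := (Finset.sum_eq_zero_iff_of_nonneg fun i _ =>
    mul_nonneg (hst i).le (sq_nonneg ‖v i - r i‖)).1
    (le_antisymm h1 (Finset.sum_nonneg fun i _ => mul_nonneg (hst i).le (sq_nonneg _)))
  ext i
  have h4 := h3 i (Finset.mem_univ i)
  rw [mul_eq_zero, or_iff_right (hst i).ne', pow_eq_zero_iff two_ne_zero, norm_eq_zero,
    sub_eq_zero] at h4
  exact h4

/-- If the displacements `u + w` tend to zero, then the elements `u` of `F` converge in norm to the
common dual solution. -/
theorem tendsto_dual (hF : IsWeightedComonotone s F) (hG : IsWeightedComonotone t G)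
    (hst : ∀ i, 0 < s i + t i) {y z u w : ℕ → ProdSpace H n} {p v : ProdSpace H n}
    (hu : ∀ k, u k ∈ F (y k)) (hw : ∀ k, w k ∈ G (z k)) (hv : v ∈ F p) (hv' : -v ∈ G p)
    (hd : ∀ k, y k - z k = δ • (u k + w k)) {C D : ℝ} (hC : ∀ k, ‖z k - p‖ ≤ C)
    (hD : ∀ k, ‖u k - v‖ ≤ D) (he : Tendsto (fun k => u k + w k) atTop (𝓝 0)) :
    Tendsto u atTop (𝓝 v) := by
  have hinner : ∀ (f g : ℕ → ProdSpace H n) (K : ℝ), (∀ k, ‖f k‖ ≤ K) →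
      Tendsto g atTop (𝓝 0) → Tendsto (fun k => ⟪f k, g k⟫_ℝ) atTop (𝓝 0) := by
    intro f g K hf hg
    refine squeeze_zero_norm (fun k => (norm_inner_le_norm _ _).trans
      (mul_le_mul_of_nonneg_right (hf k) (norm_nonneg _))) ?_
    simpa using hg.norm.const_mul K
  have hyz : Tendsto (fun k => y k - z k) atTop (𝓝 0) := by
    simpa [hd] using he.const_smul δ
  have hR : Tendsto (fun k => ⟪y k - z k, u k - v⟫_ℝ + ⟪z k - p, u k + w k⟫_ℝ) atTop (𝓝 0) := by
    have h1 := hinner _ _ D hD hyz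
    have h2 := hinner _ _ C hC he
    simpa [real_inner_comm] using h1.add h2
  -- The coordinates of `w + v` and `v - u` differ by the displacement, so that both squared norms
  -- agree in the limit.
  have hQ : ∀ i, Tendsto (fun k => ‖w k i + v i‖ ^ 2 - ‖u k i - v i‖ ^ 2) atTop (𝓝 0) := by
    intro i
    have hei : Tendsto (fun k => (u k + w k) i) atTop (𝓝 0) := tendsto_coord he i
    have hb : Tendsto (fun k => ‖(u k + w k) i‖ * (‖(u k + w k) i‖ + 2 * D)) atTop (𝓝 0) := by
      simpa using hei.norm.mul (hei.norm.add_const (2 * D))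
    refine squeeze_zero_norm (fun k => ?_) hb
    have e1 : w k i + v i = (u k + w k) i - (u k i - v i) := by
      rw [PiLp.add_apply]
      abel
    have hDi : ‖u k i - v i‖ ≤ D := (PiLp.norm_apply_le (u k - v) i).trans (hD k)
    have h1 := abs_real_inner_le_norm ((u k + w k) i) (u k i - v i)
    have h2 := mul_le_mul_of_nonneg_left hDi (norm_nonneg ((u k + w k) i))
    rw [e1, norm_sub_sq_real, Real.norm_eq_abs, abs_le]
    rw [abs_le] at h1
    constructor <;> nlinarith [sq_nonneg ‖(u k + w k) i‖]
  have hT : Tendsto (fun k => ∑ i, (s i + t i) * ‖u k i - v i‖ ^ 2) atTop (𝓝 0) := by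
    have hQs : Tendsto (fun k => ∑ i, t i * (‖w k i + v i‖ ^ 2 - ‖u k i - v i‖ ^ 2)) atTop
        (𝓝 0) := by
      simpa using tendsto_finsetSum Finset.univ fun i _ => (hQ i).const_mul (t i)
    refine squeeze_zero (fun k => Finset.sum_nonneg fun i _ =>
      mul_nonneg (hst i).le (sq_nonneg _)) (fun k => ?_) (by simpa using hR.sub hQs)
    have h1 := sum_comonotone_le hF hG (hu k) (hw k) hv hv'
    have h2 : ∑ i, (s i + t i) * ‖u k i - v i‖ ^ 2 =
        (∑ i, s i * ‖u k i - v i‖ ^ 2 + ∑ i, t i * ‖w k i + v i‖ ^ 2) -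
          ∑ i, t i * (‖w k i + v i‖ ^ 2 - ‖u k i - v i‖ ^ 2) := by
      rw [← Finset.sum_add_distrib, ← Finset.sum_sub_distrib]
      exact Finset.sum_congr rfl fun i _ => by ring
    rw [h2]
    linarith
  have hTi : ∀ i, Tendsto (fun k => ‖u k i - v i‖ ^ 2) atTop (𝓝 0) := by
    intro i
    refine squeeze_zero (fun k => sq_nonneg _) (fun k => ?_)
      (by simpa using hT.const_mul (s i + t i)⁻¹)
    rw [← div_eq_inv_mul, le_div_iff₀ (hst i), mul_comm]
    exact Finset.single_le_sum (f := fun i => (s i + t i) * ‖u k i - v i‖ ^ 2)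
      (fun i _ => mul_nonneg (hst i).le (sq_nonneg _)) (Finset.mem_univ i)
  rw [← tendsto_sub_nhds_zero_iff]
  refine tendsto_zero_of_norm_sq ?_
  simp only [PiLp.norm_sq_eq_of_L2]
  simpa using tendsto_finsetSum Finset.univ fun i _ => hTi i

/-- With nonnegative moduli, `u ∈ F y` depends on `y + γ u` in a nonexpansive way: this is the
nonexpansiveness of the resolvent of `F`, together with that of its Yosida part. -/
theorem resolvent_nonexpansive (hF : IsWeightedComonotone s F) (hs : ∀ i, 0 ≤ s i) (hγ : 0 ≤ γ)
    {y u y' u' : ProdSpace H n} (hu : u ∈ F y) (hu' : u' ∈ F y') :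
    ‖y - y'‖ ^ 2 + γ ^ 2 * ‖u - u'‖ ^ 2 ≤ ‖(y + γ • u) - (y' + γ • u')‖ ^ 2 := by
  have h1 : 0 ≤ ⟪y - y', u - u'⟫_ℝ := le_trans
    (Finset.sum_nonneg fun i _ => mul_nonneg (hs i) (sq_nonneg _)) (hF _ _ _ _ hu hu')
  have e1 : (y + γ • u) - (y' + γ • u') = (y - y') + γ • (u - u') := by module
  rw [e1, norm_add_sq_real, norm_smul, mul_pow, Real.norm_eq_abs, sq_abs, real_inner_smul_right]
  nlinarith [mul_nonneg hγ h1]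

end Iteration

section Convergence

variable {H : Type*} [NormedAddCommGroup H] [InnerProductSpace ℝ H] {n : ℕ}

/-- Convergence of the iteration, written in terms of the graph points `(y, u)` of `F` and `(z, w)`
of `G`. The limits of `u` and of `-w` are the dual solution `v`, which does not depend on the
weak limit. -/
theorem iteration_converges [CompleteSpace H] {F G : ProdSpace H n → Set (ProdSpace H n)}
    {s t : Fin n → ℝ} {γ δ : ℝ}
    (hF : IsWeightedComonotone s F) (hG : IsWeightedComonotone t G)
    (hFc : IsWeakStrongClosed F) (hGc : IsWeakStrongClosed G)
    (hs : ∀ i, 0 ≤ s i) (hst : ∀ i, 0 < s i + t i) (hγ : 0 < γ) {c : Fin n → ℝ}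
    (hc : ∀ i, 4 * c i * (s i + t i) = 4 * (γ + s i) * (δ + t i) - (γ + δ) ^ 2)
    {a η : ℝ} (ha : 0 < a) (hη0 : 0 < η) (hη : ∀ i, η ≤ 2 * c i - a)
    {x y z u w : ℕ → ProdSpace H n} (hx : ∀ k, x k = y k + γ • u k)
    (hu : ∀ k, u k ∈ F (y k)) (hw : ∀ k, w k ∈ G (z k))
    (hd : ∀ k, y k - z k = δ • (u k + w k)) (hstep : ∀ k, x (k + 1) = x k - a • (u k + w k))
    {p₀ v : ProdSpace H n} (hv : v ∈ F p₀) (hv' : -v ∈ G p₀) :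
    ∃ p, v ∈ F p ∧ -v ∈ G p ∧ InnerTendsto x atTop (p + γ • v) ∧
      (fun k => ‖x k - x (k + 1)‖) =o[atTop] (fun k : ℕ => 1 / √(k : ℝ)) ∧
      (fun k => ‖y k - y (k + 1)‖) =o[atTop] (fun k : ℕ => 1 / √(k : ℝ)) ∧
      Tendsto u atTop (𝓝 v) ∧ Tendsto (fun k => u k + w k) atTop (𝓝 0) := by
  have fejer : ∀ p, v ∈ F p → -v ∈ G p → ∀ k, ‖x (k + 1) - (p + γ • v)‖ ^ 2 ≤
      ‖x k - (p + γ • v)‖ ^ 2 - a * η * ‖u k + w k‖ ^ 2 := by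
    intro p hp hp' k
    have h := step_contraction hF hG hst hc ha.le hη (hu k) (hw k) hp hp' (hd k) (by simp)
    rw [hstep, hx]
    simpa using h
  have aη : 0 < a * η := mul_pos ha hη0
  have anti : ∀ p, v ∈ F p → -v ∈ G p → Antitone fun k => ‖x k - (p + γ • v)‖ ^ 2 := by
    intro p hp hp'
    refine antitone_nat_of_succ_le fun k => (fejer p hp hp' k).trans ?_
    exact sub_le_self _ (mul_nonneg aη.le (sq_nonneg _))
  set R := ‖x 0 - (p₀ + γ • v)‖ with hR
  have hxR : ∀ k, ‖x k - (p₀ + γ • v)‖ ≤ R := fun k =>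
    pow_le_pow_iff_left₀ (norm_nonneg _) (norm_nonneg _) two_ne_zero |>.1
      (anti p₀ hv hv' (Nat.zero_le k))
  have hsum : Summable fun k => ‖u k + w k‖ ^ 2 := by
    refine summable_of_sum_range_le (c := (a * η)⁻¹ * R ^ 2) (fun k => sq_nonneg _) fun N => ?_
    rw [← div_eq_inv_mul, le_div_iff₀ aη]
    have : ∀ N, (∑ k ∈ Finset.range N, ‖u k + w k‖ ^ 2) * (a * η) ≤
        R ^ 2 - ‖x N - (p₀ + γ • v)‖ ^ 2 := by
      intro N
      induction N with
      | zero => simp [hR]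
      | succ N ih =>
        rw [Finset.sum_range_succ, add_mul]
        linarith [fejer p₀ hv hv' N]
    exact (this N).trans (sub_le_self _ (sq_nonneg _))
  have he : Tendsto (fun k => u k + w k) atTop (𝓝 0) :=
    tendsto_zero_of_norm_sq hsum.tendsto_atTop_zero
  have hxe : ∀ k, x k - x (k + 1) = a • (u k + w k) := fun k => by
    rw [hstep, sub_sub_cancel]
  have hrate : (fun k => ‖x k - x (k + 1)‖) =o[atTop] (fun k : ℕ => 1 / √(k : ℝ)) := by
    refine isLittleO_one_div_sqrt (antitone_nat_of_succ_le fun k => ?_) (fun k => norm_nonneg _) ?_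
    · have h := step_contraction hF hG hst hc ha.le hη (hu k) (hw k) (hu (k + 1)) (hw (k + 1))
        (hd k) (hd (k + 1))
      rw [← hx, ← hx, ← hstep, ← hstep] at h
      exact pow_le_pow_iff_left₀ (norm_nonneg _) (norm_nonneg _) two_ne_zero |>.1
        (h.trans (sub_le_self _ (mul_nonneg aη.le (sq_nonneg _))))
    · simp only [hxe, norm_smul, mul_pow]
      exact hsum.mul_left _
  have hres : ∀ {y₁ u₁ y₂ u₂ : ProdSpace H n}, u₁ ∈ F y₁ → u₂ ∈ F y₂ →
      ‖y₁ - y₂‖ ^ 2 + γ ^ 2 * ‖u₁ - u₂‖ ^ 2 ≤ ‖(y₁ + γ • u₁) - (y₂ + γ • u₂)‖ ^ 2 :=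
    resolvent_nonexpansive hF hs hγ.le
  have hratey : (fun k => ‖y k - y (k + 1)‖) =o[atTop] (fun k : ℕ => 1 / √(k : ℝ)) := by
    refine (IsBigO.of_bound 1 (Eventually.of_forall fun k => ?_)).trans_isLittleO hrate
    rw [norm_norm, norm_norm, one_mul]
    have h := hres (hu k) (hu (k + 1))
    rw [← hx, ← hx] at h
    exact pow_le_pow_iff_left₀ (norm_nonneg _) (norm_nonneg _) two_ne_zero |>.1
      (by nlinarith [sq_nonneg (γ * ‖u k - u (k + 1)‖)])
  have hyR : ∀ k, ‖y k - p₀‖ ≤ R := fun k => by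
    have h := hres (hu k) hv
    rw [← hx] at h
    exact (pow_le_pow_iff_left₀ (norm_nonneg _) (norm_nonneg _) two_ne_zero |>.1
      (by nlinarith [sq_nonneg (γ * ‖u k - v‖)])).trans (hxR k)
  have huR : ∀ k, ‖u k - v‖ ≤ R / γ := fun k => by
    have h := hres (hu k) hv
    rw [← hx] at h
    rw [le_div_iff₀ hγ]
    exact (pow_le_pow_iff_left₀ (mul_nonneg (norm_nonneg _) hγ.le) (norm_nonneg _)
      two_ne_zero |>.1 (by nlinarith [sq_nonneg ‖y k - p₀‖])).trans (hxR k)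
  obtain ⟨M, hM⟩ := he.norm.bddAbove_range
  have hM' : ∀ k, ‖u k + w k‖ ≤ M := fun k => hM ⟨k, rfl⟩
  have hzy : ∀ k, z k = y k + -(δ • (u k + w k)) := fun k => by rw [← hd]; abel
  have hzR : ∀ k, ‖z k - p₀‖ ≤ R + |δ| * M := fun k => by
    have e : z k - p₀ = (y k - p₀) - δ • (u k + w k) := by rw [hzy]; abel
    rw [e]
    refine (norm_sub_le _ _).trans (add_le_add (hyR k) ?_)
    rw [norm_smul, Real.norm_eq_abs]
    exact mul_le_mul_of_nonneg_left (hM' k) (abs_nonneg _)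
  have hu_lim : Tendsto u atTop (𝓝 v) := tendsto_dual hF hG hst hu hw hv hv' hd hzR huR he
  have hw_lim : Tendsto w atTop (𝓝 (-v)) := by
    simpa using he.sub hu_lim
  have bdd : ∀ {f : ℕ → ProdSpace H n} {q : ProdSpace H n} {K : ℝ}, (∀ k, ‖f k - q‖ ≤ K) →
      ∀ k, ‖f k‖ ≤ K + ‖q‖ := fun {f q K} h k => by
    have := norm_add_le (f k - q) q
    rw [sub_add_cancel] at this
    linarith [h k]
  obtain ⟨_, ⟨p, hp, hp', rfl⟩, hlim⟩ := exists_innerTendsto_of_opial (bdd hxR)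
    {b | ∃ p, v ∈ F p ∧ -v ∈ G p ∧ b = p + γ • v} (by
      rintro _ ⟨p, hp, hp', rfl⟩
      exact ⟨_, tendsto_atTop_ciInf (anti p hp hp')
        ⟨0, by rintro _ ⟨k, rfl⟩; exact sq_nonneg _⟩⟩) (by
      intro U b hU hb
      have hy : InnerTendsto y U (b + -(γ • v)) := by
        have h := hb.add_tendsto ((hu_lim.mono_left hU).const_smul γ).neg
        simpa [hx] using h
      have hz : InnerTendsto z U (b + -(γ • v)) := by
        have h := hy.add_tendsto ((he.mono_left hU).const_smul δ).neg
        simpa only [← hzy, smul_zero, neg_zero, add_zero] using h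
      exact ⟨b + -(γ • v), hFc U y u _ _ _ hu (bdd hyR) hy (hu_lim.mono_left hU),
        hGc U z w _ _ _ hw (bdd hzR) hz (hw_lim.mono_left hU), by abel⟩)
  exact ⟨p, hp, hp', hlim, hrate, hratey, hu_lim, he⟩

end Convergence

/-! ### Resolvents, zeros and fixed points -/

section Resolvents

variable {E : Type*} [NormedAddCommGroup E] [InnerProductSpace ℝ E]

theorem mem_resolventOp {γ : ℝ} {A : E → Set E} {x y : E} :
    y ∈ resolventOp γ A x ↔ ∃ u ∈ A y, x = y + γ • u := by
  constructor
  · rintro ⟨_, rfl, _, ⟨u, hu, rfl⟩, h⟩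
    exact ⟨u, hu, h.symm⟩
  · rintro ⟨u, hu, h⟩
    exact ⟨y, rfl, _, ⟨u, hu, rfl⟩, h.symm⟩

theorem mem_zer_add {E : Type*} [NormedAddCommGroup E] {A B : E → Set E} {p : E} :
    p ∈ zer (A + B) ↔ ∃ v ∈ A p, -v ∈ B p := by
  constructor
  · rintro ⟨v, hv, w, hw, h⟩
    refine ⟨v, hv, ?_⟩
    rwa [neg_eq_of_add_eq_zero_right h]
  · rintro ⟨v, hv, hv'⟩
    exact ⟨v, hv, -v, hv', add_neg_cancel v⟩

theorem mem_relaxedResolventOp {lam γ : ℝ} {A : E → Set E} {x q : E} :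
    q ∈ relaxedResolventOp lam γ A x ↔
      ∃ y, (∃ u ∈ A y, x = y + γ • u) ∧ q = lam • y + (1 - lam) • x := by
  constructor
  · rintro ⟨_, ⟨y, hy, rfl⟩, _, rfl, h⟩
    exact ⟨y, mem_resolventOp.1 hy, h.symm⟩
  · rintro ⟨y, hy, h⟩
    exact ⟨_, ⟨y, mem_resolventOp.2 hy, rfl⟩, _, rfl, h.symm⟩

/-- The fixed points of the adaptive Douglas–Rachford operator are the points `p + γ v` with
`v ∈ A p` and `-v ∈ B p`. -/
theorem mem_fixOp_aDROp {κ γ δ lam μ : ℝ} (hκ : κ ≠ 0) (hδ : δ ≠ 0) (hμ : μ ≠ 0)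
    (hlamμ : (lam - 1) * (μ - 1) = 1) (hδγ : δ = γ * (lam - 1)) {A B : E → Set E} {x : E} :
    x ∈ fixOp (aDROp κ γ δ lam μ A B) ↔ ∃ p v, v ∈ A p ∧ -v ∈ B p ∧ x = p + γ • v := by
  have hγ : (1 - μ) * (-δ) = γ := by
    rw [hδγ]
    linear_combination γ * hlamμ
  have hr : ∀ y u : E, lam • y + (1 - lam) • (y + γ • u) = y + (-δ) • u := by
    intro y u
    rw [hδγ]
    module
  constructor
  · rintro ⟨_, rfl, _, ⟨q, hq, rfl⟩, h⟩
    have hqx : q = x := by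
      have h1 : κ • (q - x) = 0 := by
        have h2 : (1 - κ) • x + κ • q = x := h
        calc κ • (q - x) = ((1 - κ) • x + κ • q) - x := by module
          _ = 0 := by rw [h2, sub_self]
      rwa [smul_eq_zero, or_iff_right hκ, sub_eq_zero] at h1
    subst hqx
    simp only [compOp, Set.mem_iUnion] at hq
    obtain ⟨r, hr1, hr2⟩ := hq
    obtain ⟨y, ⟨u, hu, hx⟩, rfl⟩ := mem_relaxedResolventOp.1 hr1
    obtain ⟨z, ⟨w, hw, hz⟩, hq⟩ := mem_relaxedResolventOp.1 hr2
    rw [hx, hr] at hz hq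
    rw [smul_add, smul_smul, hγ] at hq
    have hyz : y = z := by
      have h1 : μ • (y - z) = 0 := by
        calc μ • (y - z) = (y + γ • u) - (μ • z + ((1 - μ) • y + γ • u)) := by module
          _ = 0 := by rw [← hq, sub_self]
      rwa [smul_eq_zero, or_iff_right hμ, sub_eq_zero] at h1
    subst hyz
    have hwu : -u = w := by
      have h1 := add_left_cancel hz
      rw [neg_smul, ← smul_neg] at h1
      exact smul_right_injective E hδ h1
    subst hwu
    exact ⟨y, u, hu, hw, hx⟩
  · rintro ⟨p, v, hv, hv', rfl⟩
    refine ⟨_, rfl, _, ⟨p + γ • v, ?_, rfl⟩, ?_⟩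
    · simp only [compOp, Set.mem_iUnion]
      refine ⟨p + (-δ) • v, mem_relaxedResolventOp.2 ⟨p, ⟨v, hv, rfl⟩, (hr p v).symm⟩,
        mem_relaxedResolventOp.2 ⟨p, ⟨-v, hv', by module⟩, ?_⟩⟩
      rw [smul_add, smul_smul, hγ]
      module
    · change (1 - κ) • (p + γ • v) + κ • (p + γ • v) = p + γ • v
      module

end Resolvents

end ADR

/-! ### Convergence of the adaptive Douglas–Rachford algorithm -/

theorem mainTheorem2 {H : Type*} [NormedAddCommGroup H] [InnerProductSpace ℝ H] [CompleteSpace H]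
    {n : ℕ} (A : Fin (n + 1) → H → Set H) (σ : Fin (n + 1) → ℝ)
    (hA : ∀ i, IsMaximalComonotone (σ i) (A i))
    (hzer : (zer (fun x => ∑ i, A i x)).Nonempty)
    (hσpos : ∀ i : Fin n, 0 < σ i.castSucc)
    (hσneg : σ (Fin.last n) < 0)
    (hσsum : ∑ i, 1 / σ i < 0)
    (γ δ lam μ : ℝ) (hγ : 0 < γ) (hδ : 0 < δ) (hlam : 0 < lam) (hμ : 0 < μ)
    (hlamμ : (lam - 1) * (μ - 1) = 1) (hδγ : δ = γ * (lam - 1))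
    (θ : Fin n → ℝ) (hθ : θ ∈ Theta σ)
    (κ : ℝ) (hκ0 : 0 < κ) (hκ1 : κ < 1)
    (hκ : (∀ i, 1 ≤ kappaStar γ δ σ θ i) ∨
      (γ = δ ∧ μ = 2 ∧ lam = 2 ∧ ∀ i, κ < kappaStar γ δ σ θ i))
    (F G : ProdSpace H n → Set (ProdSpace H n))
    (hF : F = opF (fun i => A i.castSucc)) (hG : G = opG n (A (Fin.last n)))
    (x y z : ℕ → ProdSpace H n) (hxyz : IsADRSequence κ γ δ lam μ F G x y z) :
    ∃ xbar p : ProdSpace H n,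
      xbar ∈ fixOp (aDROp κ γ δ lam μ F G) ∧
      resolventOp γ F xbar = {p} ∧
      p ∈ zer (F + G) ∧
      WeaklyTendsto x xbar ∧
      (fun k => ‖x k - x (k + 1)‖) =o[atTop] (fun k : ℕ => 1 / √(k : ℝ)) ∧
      (fun k => ‖y k - y (k + 1)‖) =o[atTop] (fun k : ℕ => 1 / √(k : ℝ)) ∧
      WeaklyTendsto y p ∧
      WeaklyTendsto z p ∧
      Tendsto (fun k => x k - y k) atTop (𝓝 (xbar - p)) ∧
      Tendsto (fun k => x k - z k) atTop (𝓝 (xbar - p)) ∧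
      γ • yosidaOp γ F xbar = {xbar - p} ∧
      γ • yosidaOp γ F xbar + zer (F + G) = fixOp (aDROp κ γ δ lam μ F G) := by
  obtain ⟨hθ0, hθ1⟩ := hθ
  have hn : n ≠ 0 := by
    rintro rfl
    simp at hθ1
  -- In both cases `κ` lies strictly below every `κ_i^*`.
  have hκ' : ∀ i, κ < kappaStar γ δ σ θ i := by
    rcases hκ with h | ⟨-, -, -, h⟩
    · exact fun i => hκ1.trans_le (h i)
    · exact h
  set s : Fin n → ℝ := fun i => σ i.castSucc with hs
  set t : Fin n → ℝ := fun i => σ (Fin.last n) * θ i with ht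
  have hst : ∀ i, 0 < s i + t i := fun i => (hθ0 i).2
  have hFm : IsWeightedComonotone s F := by
    rw [hF]
    exact isWeightedComonotone_opF fun i => (hA i.castSucc).1
  have hGm : IsWeightedComonotone t G := by
    rw [hG]
    exact isWeightedComonotone_opG hσneg (fun i => (hθ0 i).1) hθ1 hn (hA (Fin.last n)).1
  have hFc : IsWeakStrongClosed F := by
    rw [hF]
    exact isWeakStrongClosed_opF fun i => (hA i.castSucc).isWeakStrongClosed
  have hGc : IsWeakStrongClosed G := by
    rw [hG]
    exact isWeakStrongClosed_opG hn (hA (Fin.last n)).isWeakStrongClosed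
  have hγδ : 0 < γ + δ := add_pos hγ hδ
  -- The step along the displacement `u + w` has length `κ μ δ = κ (γ + δ)`.
  have hμδ : μ * δ = γ + δ := by
    rw [hδγ]
    linear_combination γ * hlamμ
  set c : Fin n → ℝ := fun i => kappaStar γ δ σ θ i * (γ + δ) / 2 with hcdef
  have hc : ∀ i, 4 * c i * (s i + t i) = 4 * (γ + s i) * (δ + t i) - (γ + δ) ^ 2 := by
    intro i
    have h1 : σ i.castSucc + σ (Fin.last n) * θ i ≠ 0 := (hst i).ne'
    simp only [hcdef, kappaStar, hs, ht]
    field_simp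
    ring
  obtain ⟨η, hη0, hη⟩ : ∃ η > 0, ∀ i, η ≤ 2 * c i - κ * μ * δ := by
    have : Nonempty (Fin n) := ⟨⟨0, Nat.pos_of_ne_zero hn⟩⟩
    obtain ⟨i₀, hi₀⟩ := Finite.exists_min fun i => 2 * c i - κ * μ * δ
    refine ⟨_, ?_, hi₀⟩
    rw [mul_assoc, hμδ]
    simp only [hcdef]
    nlinarith [hκ' i₀]
  obtain ⟨p₀, v, hv, hv'⟩ : ∃ p v, v ∈ F p ∧ -v ∈ G p := by
    obtain ⟨b, hb⟩ := hzer
    obtain ⟨g, hg, hg0⟩ := (Set.mem_fintype_sum (fun i => A i b) 0).1 hb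
    rw [Fin.sum_univ_castSucc] at hg0
    refine ⟨constVec n b, WithLp.toLp 2 fun i => g i.castSucc, ?_, ?_⟩
    · rw [hF]
      exact fun i => hg i.castSucc
    · rw [hG, mem_opG_iff hn]
      refine ⟨b, rfl, ?_⟩
      have h1 : ∑ i, (-WithLp.toLp 2 fun i : Fin n => g i.castSucc : ProdSpace H n) i =
          g (Fin.last n) := by
        simp only [PiLp.neg_apply, Finset.sum_neg_distrib]
        exact neg_eq_of_add_eq_zero_right hg0
      rw [h1]
      exact hg (Fin.last n)
  choose u hu hxu using fun k => mem_resolventOp.1 (hxyz k).1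
  choose w hw hzw using fun k => mem_resolventOp.1 (hxyz k).2.1
  have hd : ∀ k, y k - z k = δ • (u k + w k) := by
    intro k
    have h1 : z k = (1 - lam) • x k + lam • y k - δ • w k := by rw [hzw k]; abel
    rw [h1, hxu k, hδγ]
    module
  have hstep : ∀ k, x (k + 1) = x k - (κ * μ * δ) • (u k + w k) := by
    intro k
    rw [(hxyz k).2.2, mul_smul _ δ, ← hd]
    module
  obtain ⟨p, hp, hp', hlim, hrx, hry, hu_lim, he⟩ := iteration_converges hFm hGm hFc hGc
    (fun i => (hσpos i).le) hst hγ hc (mul_pos (mul_pos hκ0 hμ) hδ) hη0 hη hxu hu hw hd hstep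
    hv hv'
  have hy_lim : InnerTendsto y atTop p := by
    have h := hlim.add_tendsto (hu_lim.const_smul γ).neg
    simpa [hxu] using h
  have hz_lim : InnerTendsto z atTop p := by
    have h := hy_lim.add_tendsto (he.const_smul δ).neg
    simpa [← hd] using h
  have hres : resolventOp γ F (p + γ • v) = {p} := by
    refine Set.eq_singleton_iff_unique_mem.2 ⟨mem_resolventOp.2 ⟨v, hp, rfl⟩, fun q hq => ?_⟩
    obtain ⟨r, hr, hqr⟩ := mem_resolventOp.1 hq
    have h := resolvent_nonexpansive hFm (fun i => (hσpos i).le) hγ.le hr hp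
    rw [← hqr, sub_self, norm_zero] at h
    have h1 : ‖q - p‖ ^ 2 = 0 := by
      nlinarith [sq_nonneg ‖q - p‖, sq_nonneg (γ * ‖r - v‖)]
    exact sub_eq_zero.1 (norm_eq_zero.1 (pow_eq_zero_iff two_ne_zero |>.1 h1))
  have hfix : ∀ {b}, b ∈ fixOp (aDROp κ γ δ lam μ F G) ↔
      ∃ p v, v ∈ F p ∧ -v ∈ G p ∧ b = p + γ • v :=
    mem_fixOp_aDROp hκ0.ne' hδ.ne' hμ.ne' hlamμ hδγ
  have hyos : γ • yosidaOp γ F (p + γ • v) = {γ • v} := by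
    simp only [yosidaOp, hres, Set.singleton_sub_singleton, Set.smul_set_singleton,
      add_sub_cancel_left, smul_inv_smul₀ hγ.ne']
  refine ⟨p + γ • v, p, hfix.2 ⟨p, v, hp, hp', rfl⟩, hres, mem_zer_add.2 ⟨v, hp, hp'⟩,
    hlim.weaklyTendsto, hrx, hry, hy_lim.weaklyTendsto, hz_lim.weaklyTendsto, ?_, ?_, ?_, ?_⟩
  · simpa [hxu] using hu_lim.const_smul γ
  · have h := (hu_lim.const_smul γ).add (he.const_smul δ)
    rw [smul_zero, add_zero] at h
    rw [add_sub_cancel_left]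
    refine h.congr fun k => ?_
    rw [← hd, hxu]
    abel
  · rw [hyos, add_sub_cancel_left]
  · rw [hyos]
    ext b
    rw [Set.singleton_add, Set.mem_image, hfix]
    constructor
    · rintro ⟨q, hq, rfl⟩
      obtain ⟨r, hr, hr'⟩ := mem_zer_add.1 hq
      obtain rfl := dual_solution_unique hFm hGm hst hp hp' hr hr'
      exact ⟨q, v, hr, hr', add_comm _ _⟩
    · rintro ⟨q, r, hr, hr', rfl⟩
      obtain rfl := dual_solution_unique hFm hGm hst hp hp' hr hr'
      exact ⟨q, mem_zer_add.2 ⟨v, hr, hr'⟩, add_comm _ _⟩
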